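/- Let $\Phi^t : X \to X$, $t\in\mathbb R$, be a continuous flow on a compact metrizable space $X$, and let $\mu$ be a Borel probability measure on $X$ that is invariant and ergodic under $\Phi^t$. Let $\Delta t>0$ be such that the map $\Phi^{\Delta t}$ is ergodic with respect to $\mu$. For $x_0\in X$ and $N\in\mathbb N$ put $x_n=\Phi^{n\Delta t}(x_0)$, $\mu_N=\frac1N\sum_{n=0}^{N-1}\delta_{x_n}$, $H=L^2(X,\mu)$ and $\hat H_N=L^2(X,\mu_N)$ (complex Hilbert spaces, with inner products $\langle f,g\rangle=\int f^*g\,d\mu$ and $\langle f,g\rangle_N=\int f^*g\,d\mu_N$). Let $\iota:C(X)\to H$ and $\iota_N:C(X)\to\hat H_N$ be the canonical maps, where $C(X)$ is the space of continuous complex-valued functions with the uniform norm. Let $k:X\times X\to\mathbb R$ be a continuous symmetric kernel, and let $\{\phi_l\}_{l\in\mathbb N}$ be a real orthonormal basis of $H$ consisting of eigenvectors of the integral operator $Kf=\int_X k(\cdot,x)f(x)\,d\mu(x)$, with $K\phi_l=\lambda_l\phi_l$. (The order in which the eigenvalues are listed is immaterial.) For $\lambda_l\ne0$, let $\varphi_l=\lambda_l^{-1}\int_X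 k(\cdot,x)\phi_l(x)\,d\mu(x)\in C(X)$ be the continuous representative of $\phi_l$. Let $A$ be a bounded operator on $H$ and $\tilde A$ a bounded operator on $C(X)$ such that $A\circ\iota=\iota\circ\tilde A$. Then for $\mu$-a.e. initial condition $x_0\in X$ the following holds. Suppose given any data, possibly depending on $x_0$, as follows: 1. continuous symmetric kernels $k_N:X\times X\to\mathbb R$ converging uniformly to $k$ as $N\to\infty$; 2. for each $N$, a real orthonormal basis $\phi_{0,N},\dots,\phi_{N-1,N}$ of $\hat H_N$ (so in particular the states $x_0,\dots,x_{N-1}$ are distinct) consisting of eigenvectors of $K_Nf=\int_X k_N(\cdot,x)f(x)\,d\mu_N(x)$, with $K_N\phi_{l,N}=\lambda_{l,N}\phi_{l,N}$, chosen such that for each $l$ with $\lambda_l\neq0$ the continuous representatives $\varphi_{l,N}=\lambda_{l,N}^{-1}\int_X k_N(\cdot,x)\phi_{l,N}(x)\,d\mu_N(x)$ converge to $\varphi_l$ uniformly on $X$ as $N\to\infty$; 3. bounded operators $\hat A_N$ on $\hat H_N$ with $\|\hat A_N\|\le a$ for a constant $a$ independent of $N$, such that $\lim_{N\to\infty}\|(\hat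 A_N\circ\iota_N-\iota_N\circ\tilde A)f\|_{\hat H_N}=0$ for every $f\in C(X)$. Then, for all $i,j\in\mathbb N$ with $\lambda_i,\lambda_j\ne0$, $$\lim_{N\to\infty}\langle\phi_{i,N},\hat A_N\phi_{j,N}\rangle_N=\langle\phi_i,A\phi_j\rangle .$$ -/

import Mathlib

open Filter Topology MeasureTheory
open scoped NNReal InnerProductSpace

namespace QMDA

noncomputable section

/-- `μ` is invariant and ergodic under the flow `Φ`. -/
structure IsInvariantErgodic {X : Type*} [TopologicalSpace X] [MeasurableSpace X]
    (Φ : Flow ℝ X) (μ : Measure X) : Prop where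
  invariant : ∀ t : ℝ, MeasurePreserving (Φ t) μ μ
  ergodic : ∀ s : Set X, MeasurableSet s → (∀ t : ℝ, Φ t ⁻¹' s = s) → μ s = 0 ∨ μ sᶜ = 0

/-- The sampling measure `μ_N = (1/N) ∑_{n < N} δ_{x_n}` with `x_n = Φ^{n Δt}(x₀)`
(the zero measure for `N = 0`). -/
def samplingMeasure {X : Type*} [TopologicalSpace X] [MeasurableSpace X]
    (Φ : Flow ℝ X) (Δt : ℝ) (x₀ : X) (N : ℕ) : Measure X :=
  (N : ℝ≥0)⁻¹ • ∑ n ∈ Finset.range N, Measure.dirac (Φ ((n : ℝ) * Δt) x₀)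

instance samplingMeasure.instIsFiniteMeasure {X : Type*} [TopologicalSpace X] [MeasurableSpace X]
    (Φ : Flow ℝ X) (Δt : ℝ) (x₀ : X) (N : ℕ) : IsFiniteMeasure (samplingMeasure Φ Δt x₀ N) := by
  unfold samplingMeasure
  infer_instance

theorem integrable_L2 {X : Type*} [MeasurableSpace X] (μ : Measure X) [IsFiniteMeasure μ]
    (f : Lp ℂ 2 μ) : Integrable f μ :=
  (Lp.memLp f).integrable (by norm_num)

section Kernel

variable {X : Type*} [TopologicalSpace X] [CompactSpace X] [MeasurableSpace X] [BorelSpace X]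

/-- The canonical map `C(X) → L²(X, μ)` sending a continuous function to its class. -/
abbrev toL2 (μ : Measure X) [IsFiniteMeasure μ] : C(X, ℂ) →L[ℂ] Lp ℂ 2 μ :=
  ContinuousMap.toLp 2 μ ℂ

theorem integrable_kernel_mul [TopologicalSpace.MetrizableSpace X] (k : C(X × X, ℝ))
    (μ : Measure X) [IsFiniteMeasure μ] (f : Lp ℂ 2 μ) (x : X) :
    Integrable (fun y => (k (x, y) : ℂ) * f y) μ := by
  refine (integrable_L2 μ f).bdd_mul (c := ‖k‖) ?_ ?_
  · exact (by fun_prop : Continuous fun y => (k (x, y) : ℂ)).aestronglyMeasurable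
  · exact Eventually.of_forall fun y => by
      simpa using k.norm_coe_le_norm (x, y)

/-- The continuous function `x ↦ ∫ k(x, y) f(y) dμ(y)`, for `f ∈ L²(X, μ)`. -/
def kernelIntegral [TopologicalSpace.MetrizableSpace X] (k : C(X × X, ℝ)) (μ : Measure X)
    [IsFiniteMeasure μ] (f : Lp ℂ 2 μ) : C(X, ℂ) where
  toFun x := ∫ y, (k (x, y) : ℂ) * f y ∂μ
  continuous_toFun := by
    refine continuous_of_dominated (bound := fun y => ‖k‖ * ‖f y‖)
      (fun x => (integrable_kernel_mul k μ f x).aestronglyMeasurable) ?_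
      ((integrable_L2 μ f).norm.const_mul _) ?_
    · refine fun x => Eventually.of_forall fun y => ?_
      rw [norm_mul]
      gcongr
      simpa using k.norm_coe_le_norm (x, y)
    · exact Eventually.of_forall fun y => by fun_prop

/-- The integral operator `f ↦ ∫ k(·, y) f(y) dμ(y)` on `L²(X, μ)`. -/
def kernelOperator [TopologicalSpace.MetrizableSpace X] (k : C(X × X, ℝ)) (μ : Measure X)
    [IsFiniteMeasure μ] : Lp ℂ 2 μ →ₗ[ℂ] Lp ℂ 2 μ where
  toFun f := toL2 μ (kernelIntegral k μ f)
  map_add' f g := by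
    rw [← map_add]
    congr 1
    ext x
    change ∫ y, (k (x, y) : ℂ) * (f + g : Lp ℂ 2 μ) y ∂μ
      = (∫ y, (k (x, y) : ℂ) * f y ∂μ) + ∫ y, (k (x, y) : ℂ) * g y ∂μ
    rw [← integral_add (integrable_kernel_mul k μ f x) (integrable_kernel_mul k μ g x)]
    refine integral_congr_ae ?_
    filter_upwards [Lp.coeFn_add f g] with y hy
    rw [hy, Pi.add_apply, mul_add]
  map_smul' c f := by
    rw [RingHom.id_apply, ← map_smul]
    congr 1
    ext x
    change ∫ y, (k (x, y) : ℂ) * (c • f : Lp ℂ 2 μ) y ∂μ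
      = c • ∫ y, (k (x, y) : ℂ) * f y ∂μ
    rw [← integral_smul]
    refine integral_congr_ae ?_
    filter_upwards [Lp.coeFn_smul c f] with y hy
    rw [hy, Pi.smul_apply, smul_eq_mul, smul_eq_mul]
    ring

/-- `φ` is a real orthonormal basis of `L²(X, μ)` consisting of eigenvectors of the integral
operator with kernel `k`, with real eigenvalues `lam`. -/
structure IsRealEigenbasis [TopologicalSpace.MetrizableSpace X] {I : Type*} (k : C(X × X, ℝ))
    (μ : Measure X) [IsFiniteMeasure μ] (φ : I → Lp ℂ 2 μ) (lam : I → ℝ) : Prop where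
  orthonormal : Orthonormal ℂ φ
  span_dense : (Submodule.span ℂ (Set.range φ)).topologicalClosure = ⊤
  real : ∀ l, ∀ᵐ x ∂μ, (φ l x).im = 0
  eigen : ∀ l, kernelOperator k μ (φ l) = (lam l : ℂ) • φ l

/-- The continuous representative `x ↦ (1/lam) ∫ k(x, y) φ(y) dμ(y)` of an eigenvector `φ`
with eigenvalue `lam ≠ 0`. -/
def contRep [TopologicalSpace.MetrizableSpace X] (k : C(X × X, ℝ)) (μ : Measure X)
    [IsFiniteMeasure μ] (lam : ℝ) (φ : Lp ℂ 2 μ) : C(X, ℂ) :=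
  (lam : ℂ)⁻¹ • kernelIntegral k μ φ

end Kernel

end

end QMDA

/-! Where the eigenvalues are nonzero, everything reduces to integrals of continuous functions: `φ
i` and `φ j` have continuous representatives `f` and `g`, and `A (φ j)` is the class of `A' g`, so
the limit is `∫ conj f * A' g ∂μ`. On the sampled side, uniform convergence of the representatives,
the bounds `‖ι_N‖ ≤ 1` and `‖A_N‖ ≤ a`, and asymptotic intertwining reduce the matrix element to the
same integral against `μ_N` (`tendsto_inner_of_tendsto_intertwining`). It remains that `μ_N → μ`
weakly for a.e. `x₀`. This is Birkhoff's theorem on a countable dense subset of `C(X)`, proved here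
through running maxima of Birkhoff sums. -/

/-- The running maximum `max_{0 ≤ k ≤ n} birkhoffSum T g k`, defined by its recursion along `T`. -/
noncomputable def birkhoffMax {α : Type*} (T : α → α) (g : α → ℝ) : ℕ → α → ℝ
  | 0 => fun _ => 0
  | n + 1 => fun x => max 0 (g x + birkhoffMax T g n (T x))

/-! ### Running maxima of Birkhoff sums -/

section BirkhoffMax

variable {α : Type*} {T : α → α} {g : α → ℝ}

theorem birkhoffMax_succ (n : ℕ) (x : α) :
    birkhoffMax T g (n + 1) x = max 0 (g x + birkhoffMax T g n (T x)) := rfl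

theorem birkhoffMax_nonneg (n : ℕ) (x : α) : 0 ≤ birkhoffMax T g n x := by
  cases n with
  | zero => exact le_rfl
  | succ n => exact le_max_left _ _

theorem birkhoffMax_le_succ (n : ℕ) (x : α) :
    birkhoffMax T g n x ≤ birkhoffMax T g (n + 1) x := by
  induction n generalizing x with
  | zero => exact birkhoffMax_nonneg 1 x
  | succ n ih =>
    rw [birkhoffMax_succ, birkhoffMax_succ (n + 1)]
    gcongr
    exact ih (T x)

theorem monotone_birkhoffMax (x : α) : Monotone fun n => birkhoffMax T g n x :=
  monotone_nat_of_le_succ fun n => birkhoffMax_le_succ n x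

theorem birkhoffSum_le_birkhoffMax (n : ℕ) (x : α) :
    birkhoffSum T g n x ≤ birkhoffMax T g n x := by
  induction n generalizing x with
  | zero => simp [birkhoffMax]
  | succ n ih =>
    rw [birkhoffSum_succ', birkhoffMax_succ]
    exact le_max_of_le_right (by linarith [ih (T x)])

/-- The right side is bounded by `|g x|` and equals `g x` once the maximum at `T x` reaches `-g x`,
which is what dominated convergence needs. -/
theorem birkhoffMax_succ_sub (n : ℕ) (x : α) :
    birkhoffMax T g (n + 1) x - birkhoffMax T g n (T x)
      = max (-birkhoffMax T g n (T x)) (g x) := by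
  rw [birkhoffMax_succ, ← max_sub_sub_right, zero_sub, add_sub_cancel_right]

/-- Makes the boundedness set strictly `T`-invariant, so that ergodicity applies to it. -/
theorem bddAbove_range_birkhoffMax_comp (x : α) :
    BddAbove (Set.range fun n => birkhoffMax T g n (T x)) ↔
      BddAbove (Set.range fun n => birkhoffMax T g n x) := by
  constructor
  · rintro ⟨C, hC⟩
    refine ⟨max 0 (g x + C), ?_⟩
    rintro _ ⟨n, rfl⟩
    refine (birkhoffMax_le_succ n x).trans ?_
    rw [birkhoffMax_succ]
    gcongr
    exact hC ⟨n, rfl⟩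
  · rintro ⟨C, hC⟩
    refine ⟨C - g x, ?_⟩
    rintro _ ⟨n, rfl⟩
    have h : birkhoffMax T g (n + 1) x ≤ C := hC ⟨n + 1, rfl⟩
    rw [birkhoffMax_succ] at h
    have := (le_max_right _ _).trans h
    change birkhoffMax T g n (T x) ≤ _
    linarith

variable [MeasurableSpace α] {μ : Measure α}

theorem measurable_birkhoffMax (hT : Measurable T) (hg : Measurable g) (n : ℕ) :
    Measurable (birkhoffMax T g n) := by
  induction n with
  | zero => exact measurable_const
  | succ n ih => exact measurable_const.max (hg.add (ih.comp hT))

theorem integrable_birkhoffMax [IsFiniteMeasure μ] (hT : MeasurePreserving T μ μ)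
    (hg : Integrable g μ) (n : ℕ) : Integrable (birkhoffMax T g n) μ := by
  induction n with
  | zero => exact integrable_const _
  | succ n ih => exact (integrable_const 0).sup (hg.add (hT.integrable_comp_of_integrable ih))

/-- If the Birkhoff sums of `g` are almost surely unbounded above, then `∫ g ≥ 0`. -/
theorem integral_nonneg_of_ae_not_bddAbove_birkhoffMax [IsFiniteMeasure μ]
    (hT : MeasurePreserving T μ μ) (hg : Integrable g μ)
    (h : ∀ᵐ x ∂μ, ¬BddAbove (Set.range fun n => birkhoffMax T g n x)) : 0 ≤ ∫ x, g x ∂μ := by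
  have hint := integrable_birkhoffMax hT hg
  have hintT (n : ℕ) : Integrable (fun x => birkhoffMax T g n (T x)) μ :=
    hT.integrable_comp_of_integrable (hint n)
  have hlim : Tendsto (fun n => ∫ x, (birkhoffMax T g (n + 1) x - birkhoffMax T g n (T x)) ∂μ)
      atTop (𝓝 (∫ x, g x ∂μ)) := by
    refine tendsto_integral_of_dominated_convergence (fun x => |g x|)
      (fun n => ((hint (n + 1)).sub (hintT n)).aestronglyMeasurable) hg.abs ?_ ?_
    · refine fun n => Eventually.of_forall fun x => ?_
      have h0 : 0 ≤ birkhoffMax T g n (T x) := birkhoffMax_nonneg n (T x)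
      rw [birkhoffMax_succ_sub, Real.norm_eq_abs, abs_le]
      exact ⟨(neg_abs_le _).trans (le_max_right _ _),
        max_le (by linarith [abs_nonneg (g x)]) (le_abs_self _)⟩
    · filter_upwards [h] with x hx
      rw [← bddAbove_range_birkhoffMax_comp] at hx
      have htop := tendsto_atTop_atTop_of_monotone' (monotone_birkhoffMax (T x)) hx
      refine tendsto_const_nhds.congr' ?_
      filter_upwards [htop.eventually_ge_atTop (-g x)] with n hn
      rw [birkhoffMax_succ_sub, max_eq_right (by linarith)]
  -- By invariance each integral is `∫ (M_{n+1} - M_n)`, with `M_n` the running maximum, hence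
  -- nonnegative.
  refine ge_of_tendsto' hlim fun n => ?_
  have hcomp : ∫ x, birkhoffMax T g n (T x) ∂μ = ∫ x, birkhoffMax T g n x ∂μ := by
    have hm : AEStronglyMeasurable (birkhoffMax T g n) (μ.map T) := by
      rw [hT.map_eq]; exact (hint n).aestronglyMeasurable
    rw [← integral_map hT.aemeasurable hm, hT.map_eq]
  rw [integral_sub (hint (n + 1)) (hintT n), hcomp, sub_nonneg]
  exact integral_mono (hint n) (hint (n + 1)) (birkhoffMax_le_succ n)

end BirkhoffMax

/-! ### Birkhoff's theorem -/

namespace Ergodic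

variable {α : Type*} [MeasurableSpace α] {μ : Measure α} {T : α → α} {g : α → ℝ}

theorem ae_bddAbove_birkhoffMax [IsFiniteMeasure μ] (hT : Ergodic T μ) (hgm : Measurable g)
    (hg : Integrable g μ) (hneg : ∫ x, g x ∂μ < 0) :
    ∀ᵐ x ∂μ, BddAbove (Set.range fun n => birkhoffMax T g n x) := by
  have hmeas : MeasurableSet {x | BddAbove (Set.range fun n => birkhoffMax T g n x)} :=
    measurableSet_bddAbove_range fun n => measurable_birkhoffMax hT.measurable hgm n
  refine (hT.toPreErgodic.ae_mem_or_ae_notMem hmeas ?_).resolve_right fun h => ?_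
  · ext x
    exact bddAbove_range_birkhoffMax_comp x
  · exact hneg.not_ge
      (integral_nonneg_of_ae_not_bddAbove_birkhoffMax hT.toMeasurePreserving hg h)

/-- For `∫ g < d < c`, the sums of `g - d` are a.e. bounded by some `C`, and `n * d + C < n * c` for
large `n`. -/
theorem ae_eventually_birkhoffAverage_lt [IsProbabilityMeasure μ] (hT : Ergodic T μ)
    (hgm : Measurable g) (hg : Integrable g μ) {c : ℝ} (hc : ∫ x, g x ∂μ < c) :
    ∀ᵐ x ∂μ, ∀ᶠ n in atTop, birkhoffAverage ℝ T g n x < c := by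
  obtain ⟨d, hd, hdc⟩ := exists_between hc
  have hint : ∫ x, (g x - d) ∂μ < 0 := by
    rw [integral_sub hg (integrable_const d)]
    simpa using hd
  filter_upwards [hT.ae_bddAbove_birkhoffMax (hgm.sub_const d) (hg.sub (integrable_const d)) hint]
    with x ⟨C, hC⟩
  have hlarge : ∀ᶠ n : ℕ in atTop, C < n * (c - d) :=
    (tendsto_natCast_atTop_atTop.atTop_mul_const (sub_pos.2 hdc)).eventually_gt_atTop C
  filter_upwards [hlarge, eventually_gt_atTop 0] with n hn hn0
  have hS := (birkhoffSum_le_birkhoffMax (g := fun x => g x - d) (T := T) n x).trans (hC ⟨n, rfl⟩)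
  have hS' : birkhoffSum T (fun x => g x - d) n x = birkhoffSum T g n x - n * d := by
    simp [birkhoffSum]
  have hn' : (0 : ℝ) < n := by exact_mod_cast hn0
  rw [birkhoffAverage, smul_eq_mul, inv_mul_lt_iff₀ hn']
  linarith

/-- **Birkhoff's pointwise ergodic theorem** for an ergodic map. -/
theorem ae_tendsto_birkhoffAverage [IsProbabilityMeasure μ] (hT : Ergodic T μ)
    (hgm : Measurable g) (hg : Integrable g μ) :
    ∀ᵐ x ∂μ, Tendsto (fun n => birkhoffAverage ℝ T g n x) atTop (𝓝 (∫ x, g x ∂μ)) := by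
  have hpos (m : ℕ) : (0 : ℝ) < 1 / ((m : ℝ) + 1) := Nat.one_div_pos_of_nat
  have hup : ∀ᵐ x ∂μ, ∀ m : ℕ, ∀ᶠ n in atTop,
      birkhoffAverage ℝ T g n x < ∫ x, g x ∂μ + 1 / ((m : ℝ) + 1) :=
    ae_all_iff.2 fun m => hT.ae_eventually_birkhoffAverage_lt hgm hg (by linarith [hpos m])
  -- The lower bound is the upper bound for `-g`; the margins `1 / (m + 1)` keep the exceptional
  -- sets countable in number.
  have hlo : ∀ᵐ x ∂μ, ∀ m : ℕ, ∀ᶠ n in atTop,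
      birkhoffAverage ℝ T (-g) n x < -∫ x, g x ∂μ + 1 / ((m : ℝ) + 1) :=
    ae_all_iff.2 fun m => hT.ae_eventually_birkhoffAverage_lt hgm.neg hg.neg (by
      simp only [Pi.neg_apply, integral_neg]
      linarith [hpos m])
  filter_upwards [hup, hlo] with x hx hx'
  refine Metric.tendsto_nhds.2 fun ε hε => ?_
  obtain ⟨m, hm⟩ := exists_nat_one_div_lt hε
  filter_upwards [hx m, hx' m] with n h1 h2
  rw [birkhoffAverage_neg, Pi.neg_apply, Pi.neg_apply] at h2
  rw [Real.dist_eq, abs_lt]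
  constructor <;> linarith

end Ergodic

/-- Convergence of matrix elements under asymptotic intertwining by uniformly bounded maps. -/
theorem tendsto_inner_of_tendsto_intertwining {𝕜 E : Type*} [RCLike 𝕜] [NormedAddCommGroup E]
    [NormedSpace 𝕜 E] {H : ℕ → Type*} [∀ N, NormedAddCommGroup (H N)]
    [∀ N, InnerProductSpace 𝕜 (H N)] (ι : ∀ N, E →L[𝕜] H N) {b : ℝ} (hι : ∀ N, ‖ι N‖ ≤ b)
    (B : ∀ N, H N →L[𝕜] H N) {a : ℝ} (hB : ∀ N, ‖B N‖ ≤ a) {f g g' : E} {fN gN : ℕ → E}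
    (hf : Tendsto fN atTop (𝓝 f)) (hg : Tendsto gN atTop (𝓝 g))
    (hBg : Tendsto (fun N => ‖B N (ι N g) - ι N g'‖) atTop (𝓝 0)) {c : 𝕜}
    (hc : Tendsto (fun N => inner 𝕜 (ι N f) (ι N g')) atTop (𝓝 c)) :
    Tendsto (fun N => inner 𝕜 (ι N (fN N)) (B N (ι N (gN N)))) atTop (𝓝 c) := by
  have hb : 0 ≤ b := (norm_nonneg _).trans (hι 0)
  have ha : 0 ≤ a := (norm_nonneg _).trans (hB 0)
  have hιle (N : ℕ) (u : E) : ‖ι N u‖ ≤ b * ‖u‖ := (ι N).le_of_opNorm_le (hι N) u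
  have hBle (N : ℕ) (u : H N) : ‖B N u‖ ≤ a * ‖u‖ := (B N).le_of_opNorm_le (hB N) u
  have hf0 : Tendsto (fun N => ‖fN N - f‖) atTop (𝓝 0) := tendsto_iff_norm_sub_tendsto_zero.1 hf
  have hg0 : Tendsto (fun N => ‖gN N - g‖) atTop (𝓝 0) := tendsto_iff_norm_sub_tendsto_zero.1 hg
  suffices h : Tendsto (fun N => inner 𝕜 (ι N (fN N)) (B N (ι N (gN N)))
      - inner 𝕜 (ι N f) (ι N g')) atTop (𝓝 0) by simpa using h.add hc
  have hbound : Tendsto (fun N => b * ‖fN N - f‖ * (a * (b * ‖gN N‖))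
      + b * ‖f‖ * (a * (b * ‖gN N - g‖)) + b * ‖f‖ * ‖B N (ι N g) - ι N g'‖) atTop (𝓝 0) := by
    simpa using (((hf0.const_mul b).mul ((hg.norm.const_mul b).const_mul a)).add
      (((hg0.const_mul b).const_mul a).const_mul (b * ‖f‖))).add (hBg.const_mul (b * ‖f‖))
  refine squeeze_zero_norm (fun N => ?_) hbound
  -- Replace `fN` by `f`, then `gN` by `g`, then `B N ∘ ι N` on `g` by `ι N g'`.
  have hsplit : inner 𝕜 (ι N (fN N)) (B N (ι N (gN N))) - inner 𝕜 (ι N f) (ι N g')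
      = inner 𝕜 (ι N (fN N - f)) (B N (ι N (gN N))) + inner 𝕜 (ι N f) (B N (ι N (gN N - g)))
        + inner 𝕜 (ι N f) (B N (ι N g) - ι N g') := by
    simp only [map_sub, inner_sub_left, inner_sub_right]
    ring
  rw [hsplit]
  refine norm_add₃_le.trans (add_le_add_three ?_ ?_ ?_) <;> refine (norm_inner_le_norm _ _).trans ?_
  · exact mul_le_mul (hιle N _) ((hBle N _).trans (by gcongr; exact hιle N _))
      (norm_nonneg _) (by positivity)
  · exact mul_le_mul (hιle N _) ((hBle N _).trans (by gcongr; exact hιle N _))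
      (norm_nonneg _) (by positivity)
  · gcongr
    exact hιle N f

/-! ### Equidistribution of orbits and continuous representatives -/

namespace QMDA

section Sampling

theorem iterate_flow {X : Type*} [TopologicalSpace X] (Φ : Flow ℝ X) (t : ℝ) (n : ℕ) (x : X) :
    (Φ t)^[n] x = Φ ((n : ℝ) * t) x := by
  induction n generalizing x with
  | zero => simp
  | succ n ih =>
    rw [Function.iterate_succ_apply, ih, ← Φ.map_add]
    push_cast
    ring_nf

variable {X : Type*} [TopologicalSpace X] [MeasurableSpace X]

theorem samplingMeasure_univ_le_one (Φ : Flow ℝ X) (Δt : ℝ) (x₀ : X) (N : ℕ) :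
    samplingMeasure Φ Δt x₀ N Set.univ ≤ 1 := by
  rcases Nat.eq_zero_or_pos N with rfl | hN
  · simp [samplingMeasure]
  · have h : (N : ℝ≥0) ≠ 0 := by exact_mod_cast hN.ne'
    have h' : ((N : ℝ≥0)⁻¹ * (N : ℝ≥0) : ℝ≥0) = 1 := inv_mul_cancel₀ h
    simp only [samplingMeasure, Measure.smul_apply, Measure.finsetSum_apply, measure_univ,
      Finset.sum_const, Finset.card_range, nsmul_eq_mul, mul_one, ENNReal.smul_def, smul_eq_mul]
    exact_mod_cast h'.le

variable [CompactSpace X]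

theorem norm_integral_le_of_univ_le_one (μ : Measure X) [IsFiniteMeasure μ]
    (hμ : μ Set.univ ≤ 1) (f : C(X, ℂ)) : ‖∫ x, f x ∂μ‖ ≤ ‖f‖ := by
  refine (norm_integral_le_of_norm_le_const
    (Eventually.of_forall fun x => f.norm_coe_le_norm x)).trans ?_
  refine mul_le_of_le_one_right (norm_nonneg _) ?_
  exact ENNReal.toReal_le_of_le_ofReal zero_le_one (by simpa using hμ)

variable [BorelSpace X]

theorem norm_toL2_le (μ : Measure X) [IsFiniteMeasure μ] (hμ : μ Set.univ ≤ 1) :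
    ‖toL2 μ‖ ≤ 1 := by
  refine (ContinuousMap.toLp_norm_le μ).trans ?_
  have h : measureUnivNNReal μ ≤ 1 := by
    rw [← ENNReal.coe_le_coe, coe_measureUnivNNReal]
    exact_mod_cast hμ
  exact_mod_cast NNReal.rpow_le_one h (by positivity)

theorem inner_toL2 (μ : Measure X) [IsFiniteMeasure μ] (f g : C(X, ℂ)) :
    ⟪toL2 μ f, toL2 μ g⟫_ℂ = ∫ x, (star f * g) x ∂μ := by
  rw [ContinuousMap.inner_toLp]
  refine integral_congr_ae (Eventually.of_forall fun x => ?_)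
  simp [mul_comm]

variable [TopologicalSpace.MetrizableSpace X]

theorem integral_samplingMeasure (Φ : Flow ℝ X) (Δt : ℝ) (x₀ : X) (N : ℕ) (f : C(X, ℂ)) :
    ∫ x, f x ∂samplingMeasure Φ Δt x₀ N = birkhoffAverage ℝ (Φ Δt) f N x₀ := by
  have hint : ∀ n ∈ Finset.range N, Integrable f (Measure.dirac (Φ ((n : ℝ) * Δt) x₀)) :=
    fun n _ => f.continuous.integrable_of_hasCompactSupport (HasCompactSupport.of_compactSpace _)
  rw [samplingMeasure, integral_smul_nnreal_measure, integral_finsetSum_measure hint,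
    birkhoffAverage, birkhoffSum]
  simp only [integral_dirac, iterate_flow]
  simp [NNReal.smul_def]

theorem ae_tendsto_integral_samplingMeasure (Φ : Flow ℝ X) (Δt : ℝ) (μ : Measure X)
    [IsProbabilityMeasure μ] (herg : Ergodic (Φ Δt) μ) (f : C(X, ℂ)) :
    ∀ᵐ x₀ ∂μ, Tendsto (fun N => ∫ x, f x ∂samplingMeasure Φ Δt x₀ N) atTop
      (𝓝 (∫ x, f x ∂μ)) := by
  have hint : Integrable f μ :=
    f.continuous.integrable_of_hasCompactSupport (HasCompactSupport.of_compactSpace _)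
  have hre := herg.ae_tendsto_birkhoffAverage
    (g := fun x => (f x).re) (by fun_prop) hint.re
  have him := herg.ae_tendsto_birkhoffAverage
    (g := fun x => (f x).im) (by fun_prop) hint.im
  filter_upwards [hre, him] with x₀ h1 h2
  simp only [integral_samplingMeasure]
  have h := (Complex.continuous_ofReal.tendsto _ |>.comp h1).add
    ((Complex.continuous_ofReal.tendsto _ |>.comp h2).mul_const Complex.I)
  have hval : ((∫ x, (f x).re ∂μ : ℝ) : ℂ) + ((∫ x, (f x).im ∂μ : ℝ) : ℂ) * Complex.I
      = ∫ x, f x ∂μ := integral_re_add_im hint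
  rw [hval] at h
  refine h.congr fun N => ?_
  apply Complex.ext <;> simp [birkhoffAverage, birkhoffSum]

/-- Almost every orbit equidistributes: time averages of all continuous observables converge
simultaneously to their space averages. -/
theorem ae_forall_tendsto_integral_samplingMeasure (Φ : Flow ℝ X) (Δt : ℝ) (μ : Measure X)
    [IsProbabilityMeasure μ] (herg : Ergodic (Φ Δt) μ) :
    ∀ᵐ x₀ ∂μ, ∀ f : C(X, ℂ), Tendsto (fun N => ∫ x, f x ∂samplingMeasure Φ Δt x₀ N) atTop
      (𝓝 (∫ x, f x ∂μ)) := by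
  -- Separability of `C(X)` yields one null set for all `f`; integration is 1-Lipschitz for measures
  -- of mass at most one, so an `ε / 3` argument suffices.
  have hall := ae_all_iff.2 fun m : ℕ =>
    ae_tendsto_integral_samplingMeasure Φ Δt μ herg (TopologicalSpace.denseSeq C(X, ℂ) m)
  filter_upwards [hall] with x₀ hx₀ f
  have hsub (ν : Measure X) [IsFiniteMeasure ν] (hν : ν Set.univ ≤ 1) (u v : C(X, ℂ)) :
      dist (∫ x, u x ∂ν) (∫ x, v x ∂ν) ≤ dist u v := by
    have hu (w : C(X, ℂ)) : Integrable w ν :=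
      w.continuous.integrable_of_hasCompactSupport (HasCompactSupport.of_compactSpace _)
    rw [dist_eq_norm, dist_eq_norm, ← integral_sub (hu u) (hu v)]
    exact norm_integral_le_of_univ_le_one ν hν (u - v)
  refine Metric.tendsto_nhds.2 fun ε hε => ?_
  obtain ⟨m, hm⟩ := (TopologicalSpace.denseRange_denseSeq C(X, ℂ)).exists_dist_lt f
    (show 0 < ε / 3 by positivity)
  filter_upwards [Metric.tendsto_nhds.1 (hx₀ m) (ε / 3) (by positivity)] with N hN
  have h1 := hsub _ (samplingMeasure_univ_le_one Φ Δt x₀ N) f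
    (TopologicalSpace.denseSeq C(X, ℂ) m)
  have h2 := hsub μ prob_le_one (TopologicalSpace.denseSeq C(X, ℂ) m) f
  rw [dist_comm _ f] at h2
  refine (dist_triangle4 _ _ _ _).trans_lt (add_lt_add_of_le_of_lt (add_le_add h1 hN.le)
    (h2.trans_lt hm) |>.trans ?_)
  linarith

theorem toL2_contRep {I : Type*} {k : C(X × X, ℝ)} {μ : Measure X} [IsFiniteMeasure μ]
    {φ : I → Lp ℂ 2 μ} {lam : I → ℝ} (h : IsRealEigenbasis k μ φ lam) {l : I} (hl : lam l ≠ 0) :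
    toL2 μ (contRep k μ (lam l) (φ l)) = φ l := by
  have hl' : (lam l : ℂ) ≠ 0 := by exact_mod_cast hl
  rw [contRep, map_smul]
  exact (congrArg _ (h.eigen l)).trans (inv_smul_smul₀ hl' _)

theorem contRep_ne_zero {I : Type*} {k : C(X × X, ℝ)} {μ : Measure X} [IsFiniteMeasure μ]
    {φ : I → Lp ℂ 2 μ} {lam : I → ℝ} (h : IsRealEigenbasis k μ φ lam) {l : I} (hl : lam l ≠ 0) :
    contRep k μ (lam l) (φ l) ≠ 0 := fun h0 =>
  h.orthonormal.ne_zero l (by rw [← toL2_contRep h hl, h0, map_zero])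

/-- If continuous representatives of the `l`-th eigenvectors have a nonzero limit, then they
eventually represent the eigenvectors. -/
theorem eventually_toL2_contRep_eq {μN : ℕ → Measure X} [∀ N, IsFiniteMeasure (μN N)]
    {kN : ℕ → C(X × X, ℝ)} {φN : (N : ℕ) → ℕ → Lp ℂ 2 (μN N)} {lamN : ℕ → ℕ → ℝ}
    (hN : ∀ N, IsRealEigenbasis (kN N) (μN N) (fun l : Fin N => φN N l)
      (fun l : Fin N => lamN N l)) {l : ℕ} {f : C(X, ℂ)} (hf : f ≠ 0)
    (hlim : Tendsto (fun N => contRep (kN N) (μN N) (lamN N l) (φN N l)) atTop (𝓝 f)) :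
    ∀ᶠ N in atTop, toL2 (μN N) (contRep (kN N) (μN N) (lamN N l) (φN N l)) = φN N l := by
  filter_upwards [hlim.eventually_ne hf, eventually_gt_atTop l] with N hne hl
  -- If `lamN N l = 0`, the convention `0⁻¹ = 0` makes the representative vanish, contrary to `hne`.
  refine toL2_contRep (hN N) (l := ⟨l, hl⟩) fun h0 => hne ?_
  simp only at h0
  simp [contRep, h0]

end Sampling

end QMDA

/-! ### Convergence of matrix elements -/

theorem mainTheorem2 {X : Type*} [TopologicalSpace X] [CompactSpace X]
    [TopologicalSpace.MetrizableSpace X] [MeasurableSpace X] [BorelSpace X]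
    (Φ : Flow ℝ X) (μ : Measure X) [IsProbabilityMeasure μ]
    (hμ : QMDA.IsInvariantErgodic Φ μ)
    (Δt : ℝ) (hΔt : 0 < Δt) (herg : Ergodic (Φ Δt) μ)
    -- the limit kernel and a real orthonormal eigenbasis of its integral operator on `L²(μ)`
    (k : C(X × X, ℝ)) (hk : ∀ x y, k (x, y) = k (y, x))
    (φ : ℕ → Lp ℂ 2 μ) (lam : ℕ → ℝ) (hφ : QMDA.IsRealEigenbasis k μ φ lam)
    -- bounded operators on `L²(μ)` and on `C(X)` intertwined by the canonical map
    (A : Lp ℂ 2 μ →L[ℂ] Lp ℂ 2 μ) (A' : C(X, ℂ) →L[ℂ] C(X, ℂ))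
    (hA : ∀ f : C(X, ℂ), A (QMDA.toL2 μ f) = QMDA.toL2 μ (A' f)) :
    ∀ᵐ x₀ ∂μ,
      -- (possibly data-dependent) kernels converging uniformly to `k`
      ∀ kN : ℕ → C(X × X, ℝ), (∀ N x y, kN N (x, y) = kN N (y, x)) →
      Tendsto kN atTop (𝓝 k) →
      -- real orthonormal eigenbases of `L²(μ_N)`; only the indices `l < N` matter
      ∀ (φN : (N : ℕ) → ℕ → Lp ℂ 2 (QMDA.samplingMeasure Φ Δt x₀ N)) (lamN : ℕ → ℕ → ℝ),
      (∀ N, QMDA.IsRealEigenbasis (kN N) (QMDA.samplingMeasure Φ Δt x₀ N)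
        (fun l : Fin N => φN N l) (fun l : Fin N => lamN N l)) →
      -- chosen so that continuous representatives converge uniformly when `lam l ≠ 0`
      (∀ l, lam l ≠ 0 →
        Tendsto (fun N => QMDA.contRep (kN N) (QMDA.samplingMeasure Φ Δt x₀ N) (lamN N l) (φN N l))
          atTop (𝓝 (QMDA.contRep k μ (lam l) (φ l)))) →
      -- uniformly bounded operators on `L²(μ_N)` that asymptotically intertwine with `A'`
      ∀ (AN : (N : ℕ) → Lp ℂ 2 (QMDA.samplingMeasure Φ Δt x₀ N) →L[ℂ]
          Lp ℂ 2 (QMDA.samplingMeasure Φ Δt x₀ N)) (a : ℝ),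
      (∀ N, ‖AN N‖ ≤ a) →
      (∀ f : C(X, ℂ),
        Tendsto (fun N => ‖AN N (QMDA.toL2 (QMDA.samplingMeasure Φ Δt x₀ N) f)
          - QMDA.toL2 (QMDA.samplingMeasure Φ Δt x₀ N) (A' f)‖) atTop (𝓝 0)) →
      ∀ i j : ℕ, lam i ≠ 0 → lam j ≠ 0 →
        Tendsto (fun N => ⟪φN N i, AN N (φN N j)⟫_ℂ) atTop (𝓝 ⟪φ i, A (φ j)⟫_ℂ) := by
  -- The null set is fixed before any data appear, so the data may depend on `x₀`.
  filter_upwards [QMDA.ae_forall_tendsto_integral_samplingMeasure Φ Δt μ herg] with x₀ hx₀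
  intro kN _ _ φN lamN hN hlim AN a hAN hint i j hi hj
  have hval : ⟪φ i, A (φ j)⟫_ℂ = ⟪QMDA.toL2 μ (QMDA.contRep k μ (lam i) (φ i)),
      QMDA.toL2 μ (A' (QMDA.contRep k μ (lam j) (φ j)))⟫_ℂ := by
    rw [← hA, QMDA.toL2_contRep hφ hi, QMDA.toL2_contRep hφ hj]
  rw [hval]
  have hinner : Tendsto (fun N => ⟪QMDA.toL2 (QMDA.samplingMeasure Φ Δt x₀ N)
      (QMDA.contRep k μ (lam i) (φ i)), QMDA.toL2 (QMDA.samplingMeasure Φ Δt x₀ N)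
      (A' (QMDA.contRep k μ (lam j) (φ j)))⟫_ℂ) atTop
      (𝓝 ⟪QMDA.toL2 μ (QMDA.contRep k μ (lam i) (φ i)),
        QMDA.toL2 μ (A' (QMDA.contRep k μ (lam j) (φ j)))⟫_ℂ) := by
    simp only [QMDA.inner_toL2]
    exact hx₀ _
  have hmain := tendsto_inner_of_tendsto_intertwining
    (fun N => QMDA.toL2 (QMDA.samplingMeasure Φ Δt x₀ N))
    (fun N => QMDA.norm_toL2_le _ (QMDA.samplingMeasure_univ_le_one Φ Δt x₀ N))
    AN hAN (hlim i hi) (hlim j hj) (hint _) hinner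
  refine hmain.congr' ?_
  filter_upwards [QMDA.eventually_toL2_contRep_eq hN (QMDA.contRep_ne_zero hφ hi) (hlim i hi),
    QMDA.eventually_toL2_contRep_eq hN (QMDA.contRep_ne_zero hφ hj) (hlim j hj)] with N h1 h2
  rw [h1, h2]
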